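/- \textbf{Theorem.} Fix an integer $d\ge 0$. Then there is a function $Q:\mathbb{N}\to\mathbb{N}$ with $Q(n)=O\!\left(n^{3/2}\sqrt{\log n}\right)$ as $n\to\infty$, where the implied constant depends only on $d$, such that for every finite nonempty set $V$, with $n=|V|$, there is a deterministic adaptive algorithm with the following property. Let $T=(V,E,r)$ be any directed rooted tree (of arbitrary height) with vertex set $V$ and maximum degree at most $d$; that is, $T$ is a directed acyclic graph in which $r$ is the only vertex without incoming edges, there is exactly one directed path from $r$ to each vertex, and in-degree plus out-degree of every vertex is at most $d$. Knowing only $V$ and $d$, and obtaining information about $T$ only through \emph{path queries} (for $u,v\in V$, $\mathrm{path}(u,v)$ tells whether $T$ has a directed path from $u$ to $v$), each of which may depend on the answers to the previous ones, the algorithm asks at most $Q(n)$ queries and outputs the root $r$ and the edge set $E$ exactly. -/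

import Mathlib

open Filter Asymptotics

/-! Directed graphs on a vertex set `V` are Mathlib's `Digraph V`; `G.Adj u v` says that the
directed edge `(u, v)` is present. -/

/-- `IsDirPath G u v p`: the list of vertices `p` is a directed path of `G` from `u` to `v`.
The one-vertex list `[u]` is the path of length zero from `u` to itself. (In the acyclic graphs
considered here directed paths never repeat a vertex.) -/
def IsDirPath {V : Type*} (G : Digraph V) (u v : V) (p : List V) : Prop :=
  p.head? = some u ∧ p.getLast? = some v ∧ p.IsChain G.Adj

/-- A directed acyclic graph: no vertex can be reached from itself by one or more edges. -/
def IsDAG {V : Type*} (G : Digraph V) : Prop :=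
  ∀ v : V, ¬ Relation.TransGen G.Adj v v

/-- `G` is a directed rooted tree (arborescence) with root `r`: a directed acyclic graph in which
`r` is the only vertex without incoming edges, and which has exactly one directed path from `r`
to every vertex. -/
structure IsRootedTree {V : Type*} (G : Digraph V) (r : V) : Prop where
  acyclic : IsDAG G
  root_iff : ∀ v : V, (∀ u : V, ¬ G.Adj u v) ↔ v = r
  existsUnique_path : ∀ v : V, ∃! p : List V, IsDirPath G r v p

/-- The maximum degree of `G` is at most `d`: in-degree plus out-degree of every vertex is at most
`d`. (Only used for finite `V`.) -/
def MaxDegreeLE {V : Type*} (G : Digraph V) (d : ℕ) : Prop :=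
  ∀ v : V, {u : V | G.Adj u v}.ncard + {w : V | G.Adj v w}.ncard ≤ d

open Classical in
/-- The answer to the path query `path(u, v)` in `G`: is there a directed path from `u` to `v`? -/
noncomputable def pathQuery {V : Type*} (G : Digraph V) (u v : V) : Bool :=
  decide (∃ p : List V, IsDirPath G u v p)

/-- A deterministic adaptive algorithm that asks path queries about an unknown directed graph with
the known vertex set `V`, as a decision tree. Either it stops and reports a root and a directed
graph, or it asks the query `path(u, v)` and goes on according to the answer. -/
inductive PathQueryAlgorithm (V : Type*) where
  | output (root : V) (graph : Digraph V) : PathQueryAlgorithm V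
  | query (u v : V) (ifTrue ifFalse : PathQueryAlgorithm V) : PathQueryAlgorithm V

namespace PathQueryAlgorithm

/-- What the algorithm reports when its queries are answered by `oracle`. -/
def run {V : Type*} : PathQueryAlgorithm V → (V → V → Bool) → V × Digraph V
  | output r G, _ => (r, G)
  | query u v a b, oracle =>
      match oracle u v with
      | true => a.run oracle
      | false => b.run oracle

/-- The number of queries the algorithm asks when they are answered by `oracle`. -/
def numQueries {V : Type*} : PathQueryAlgorithm V → (V → V → Bool) → ℕ
  | output _ _, _ => 0
  | query u v a b, oracle =>
      match oracle u v with
      | true => a.numQueries oracle + 1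
      | false => b.numQueries oracle + 1

/-- The algorithm `A` learns all rooted trees on `V` of maximum degree at most `d` with at most `q`
path queries: for each of them it reports the correct root and exactly the correct edges. -/
def LearnsRootedTrees {V : Type*} (A : PathQueryAlgorithm V) (d q : ℕ) : Prop :=
  ∀ (G : Digraph V) (r : V), IsRootedTree G r → MaxDegreeLE G d →
    A.run (pathQuery G) = (r, G) ∧ A.numQueries (pathQuery G) ≤ q

end PathQueryAlgorithm

/-! Reachability in a rooted tree is a forest order, and its covering pairs are the edges, so it
suffices to learn the order. This is done by divide and conquer. On a set of size m, find a vertex s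
such that the subtree of s and its complement both have at least e = ⌊m/(8(d+1))⌋ elements, recurse
on both, and glue with the queries path(x, s) alone. If a split costs O(m√(m log m)), the rate √(m
log m) drops by a constant factor at each level, and the total keeps this order.

To find s, call a vertex light if it has fewer than e descendants and heavy if it has more than m -
e; any other vertex splits. Walking from the root through heavy children ends at a splitting vertex,
since at most d light children cannot exhaust a heavy subtree, but the walk may be long. To shorten
it, first query a fixed sparse set of pairs, about K ≈ √(m log m) per vertex, with a pair from every
K-set to every K-set (`exists_sparse_neighbors`). A vertex is live if at least t ≈ m/(4K) of its
sampled pairs reveal descendants among the remaining vertices. Fully query a live vertex with no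
other live vertex among its known descendants. If light, its subtree is deleted, which removes at
least t vertices; if heavy, the search moves below it. The heavy vertices so found have no sampled
pair from an earlier to a later one, so there are fewer than 2K (`length_lt`). Once nothing is live,
at most K heavy vertices remain (`card_heavy_lt`) and the plain walk is affordable. -/

/-- `Learnable P C q`: when the oracle is only known to lie in `C`, at most `q` adaptive queries
narrow it down to a set of consistent oracles that is empty or satisfies `P`. -/
inductive Learnable {V : Type*} (P : Set (V → V → Bool) → Prop) :
    Set (V → V → Bool) → ℕ → Prop
  | done {C : Set (V → V → Bool)} {q : ℕ} : (C.Nonempty → P C) → Learnable P C q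
  | query {C : Set (V → V → Bool)} {q : ℕ} (u v : V) :
      Learnable P {o ∈ C | o u v = true} q → Learnable P {o ∈ C | o u v = false} q →
      Learnable P C (q + 1)

/-- The elements of `W` that are reachable from `x`. -/
def desc {V : Type*} (o : V → V → Bool) (W : Finset V) (x : V) : Finset V :=
  W.filter fun y => o x y = true

/-- The elements of `S` that are not reachable from other elements of `S`. -/
def tops {V : Type*} [DecidableEq V] (o : V → V → Bool) (S : Finset V) : Finset V :=
  S.filter fun x => ∀ y ∈ S, o y x = true → y = x

/-- The relation `o` is a partial order in which the elements below a given one form a chain. -/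
structure IsForestOrder {V : Type*} (o : V → V → Bool) : Prop where
  refl : ∀ x, o x x = true
  trans : ∀ {x y z}, o x y = true → o y z = true → o x z = true
  antisymm : ∀ {x y}, o x y = true → o y x = true → x = y
  comparable : ∀ {x y z}, o x z = true → o y z = true → o x y = true ∨ o y x = true

/-- The forest order `o` restricts to the reachability order of a rooted tree on `W` in which
every vertex has at most `d` children. -/
structure IsTreeOn {V : Type*} [DecidableEq V] (o : V → V → Bool) (W : Finset V) (d : ℕ) :
    Prop extends IsForestOrder o where
  root : ∃ r ∈ W, ∀ x ∈ W, o r x = true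
  degree : ∀ x ∈ W, (tops o ((desc o W x).erase x)).card ≤ d

/-- All oracles in `C` agree on a common vertex of `W` whose set of descendants in `W`, and the
complement of this set, have at least `e` elements each. -/
def Splits {V : Type*} (W : Finset V) (e : ℕ) (C : Set (V → V → Bool)) : Prop :=
  ∃ s ∈ W, ∃ D ⊆ W, e ≤ D.card ∧ D.card + e ≤ W.card ∧ ∀ o ∈ C, desc o W s = D

/-! ### Composing query strategies -/

namespace Learnable

variable {V : Type*} {P P' : Set (V → V → Bool) → Prop} {C : Set (V → V → Bool)} {q q' : ℕ}

theorem mono (h : Learnable P C q) (hq : q ≤ q') : Learnable P C q' := by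
  induction h generalizing q' with
  | done h => exact .done h
  | query u v _ _ h₁ h₂ =>
    obtain ⟨k, rfl⟩ : ∃ k, q' = k + 1 := ⟨q' - 1, by omega⟩
    exact .query u v (h₁ (by omega)) (h₂ (by omega))

theorem of_nonempty (h : C.Nonempty → Learnable P C q) : Learnable P C q := by
  by_cases hC : C.Nonempty
  · exact h hC
  · exact .done fun h' => absurd h' hC

theorem bind (h : Learnable P C q)
    (h' : ∀ C' ⊆ C, C'.Nonempty → P C' → Learnable P' C' q') : Learnable P' C (q + q') := by
  induction h with
  | done h =>
    exact .of_nonempty fun hC => (h' _ subset_rfl hC (h hC)).mono (by omega)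
  | @query C q u v _ _ h₁ h₂ =>
    rw [add_right_comm]
    exact .query u v (h₁ fun C' hC' => h' C' (hC'.trans (Set.sep_subset _ _)))
      (h₂ fun C' hC' => h' C' (hC'.trans (Set.sep_subset _ _)))

theorem pairs (E : Finset (V × V)) (h : ∀ C' ⊆ C, C'.Nonempty →
      (∀ o ∈ C', ∀ o' ∈ C', ∀ p ∈ E, o p.1 p.2 = o' p.1 p.2) → Learnable P C' q) :
    Learnable P C (E.card + q) := by
  classical
  refine bind (P := fun C' => ∀ o ∈ C', ∀ o' ∈ C', ∀ p ∈ E, o p.1 p.2 = o' p.1 p.2) ?_ h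
  clear h
  induction E using Finset.induction_on generalizing C with
  | empty => exact .done fun _ => by simp
  | insert p E hp ih =>
    rw [Finset.card_insert_of_notMem hp]
    have aux : ∀ b : Bool, Learnable (fun C' => ∀ o ∈ C', ∀ o' ∈ C', ∀ p' ∈ insert p E,
        o p'.1 p'.2 = o' p'.1 p'.2) {o ∈ C | o p.1 p.2 = b} E.card := by
      intro b
      refine (bind (q' := 0) ih fun C' hC' _ hE => .done fun _ o ho o' ho' p' hp' => ?_)
      rcases Finset.mem_insert.1 hp' with rfl | hp'
      · rw [(hC' ho).2, (hC' ho').2]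
      · exact hE o ho o' ho' p' hp'
    exact .query p.1 p.2 (aux true) (aux false)

theorem row (W : Finset V) (x : V) (h : ∀ C' ⊆ C, C'.Nonempty → ∀ D ⊆ W,
      (∀ o ∈ C', desc o W x = D) → Learnable P C' q) : Learnable P C (W.card + q) := by
  classical
  have hcard : (W.image fun y => (x, y)).card = W.card :=
    Finset.card_image_of_injective _ (Prod.mk_right_injective x)
  rw [← hcard]
  refine pairs _ fun C' hC' ⟨o, ho⟩ hE => h C' hC' ⟨o, ho⟩ (desc o W x)
    (Finset.filter_subset _ _) fun o' ho' => Finset.filter_congr fun y hy => ?_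
  rw [hE o ho o' ho' (x, y) (Finset.mem_image_of_mem _ hy)]

theorem column (W : Finset V) (x : V) (h : ∀ C' ⊆ C, C'.Nonempty →
      (∀ o ∈ C', ∀ o' ∈ C', ∀ y ∈ W, o y x = o' y x) → Learnable P C' q) :
    Learnable P C (W.card + q) := by
  classical
  have hcard : (W.image fun y => (y, x)).card = W.card :=
    Finset.card_image_of_injective _ (Prod.mk_left_injective x)
  rw [← hcard]
  exact pairs _ fun C' hC' hne hE => h C' hC' hne fun o ho o' ho' y hy =>
    hE o ho o' ho' (y, x) (Finset.mem_image_of_mem _ hy)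

/-- Linear scan: a new element replaces the champion exactly when it reaches it. By transitivity and
antisymmetry the replacement is again maximal. -/
theorem maximal {S : Finset V} (hS : S.Nonempty) (hC : ∀ o ∈ C, IsForestOrder o) :
    Learnable (fun C' => ∃ c ∈ S, ∀ o ∈ C', ∀ y ∈ S, o y c = true → y = c) C S.card := by
  classical
  induction hS using Finset.Nonempty.cons_induction with
  | singleton a => exact .done fun _ => ⟨a, by simp, by simp⟩
  | cons a S ha hS ih =>
    rw [Finset.card_cons]
    refine bind ih fun C' hC' _ ⟨c, hc, hmax⟩ => .query a c (.done fun _ => ?_) (.done fun _ => ?_)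
    · refine ⟨a, by simp, fun o ho y hy hya => ?_⟩
      have ho' := hC o (hC' ho.1)
      rcases Finset.mem_cons.1 hy with rfl | hy
      · rfl
      · have := hmax o ho.1 y hy (ho'.trans hya ho.2)
        exact this ▸ ho'.antisymm (this ▸ hya) ho.2
    · refine ⟨c, by simp [hc], fun o ho y hy hyc => ?_⟩
      rcases Finset.mem_cons.1 hy with rfl | hy
      · simp [ho.2] at hyc
      · exact hmax o ho.1 y hy hyc

theorem minimal {S : Finset V} (hS : S.Nonempty) (hC : ∀ o ∈ C, IsForestOrder o) :
    Learnable (fun C' => ∃ c ∈ S, ∀ o ∈ C', ∀ y ∈ S, o c y = true → y = c) C S.card := by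
  classical
  induction hS using Finset.Nonempty.cons_induction with
  | singleton a => exact .done fun _ => ⟨a, by simp, by simp⟩
  | cons a S ha hS ih =>
    rw [Finset.card_cons]
    refine bind ih fun C' hC' _ ⟨c, hc, hmin⟩ => .query c a (.done fun _ => ?_) (.done fun _ => ?_)
    · refine ⟨a, by simp, fun o ho y hy hay => ?_⟩
      have ho' := hC o (hC' ho.1)
      rcases Finset.mem_cons.1 hy with rfl | hy
      · rfl
      · have := hmin o ho.1 y hy (ho'.trans ho.2 hay)
        exact this ▸ ho'.antisymm ho.2 (this ▸ hay)
    · refine ⟨c, by simp [hc], fun o ho y hy hcy => ?_⟩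
      rcases Finset.mem_cons.1 hy with rfl | hy
      · simp [ho.2] at hcy
      · exact hmin o ho.1 y hy hcy

end Learnable

/-! ### Forest orders and the plain heavy walk -/

section Order

variable {V : Type*} {o : V → V → Bool} {W S : Finset V} {x y : V} {d : ℕ}

theorem mem_desc : y ∈ desc o W x ↔ y ∈ W ∧ o x y = true := Finset.mem_filter

theorem desc_subset : desc o W x ⊆ W := Finset.filter_subset _ _

theorem IsForestOrder.desc_subset_desc (ho : IsForestOrder o) (h : o x y = true) :
    desc o W y ⊆ desc o W x := fun _ hz =>
  mem_desc.2 ⟨(mem_desc.1 hz).1, ho.trans h (mem_desc.1 hz).2⟩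

variable [DecidableEq V]

theorem mem_tops : x ∈ tops o S ↔ x ∈ S ∧ ∀ y ∈ S, o y x = true → y = x := Finset.mem_filter

theorem IsForestOrder.strictDesc_closed (ho : IsForestOrder o) {z : V}
    (hy : y ∈ (desc o W x).erase x) (hz : z ∈ W) (h : o y z = true) :
    z ∈ (desc o W x).erase x := by
  rw [Finset.mem_erase, mem_desc] at *
  refine ⟨?_, hz, ho.trans hy.2.2 h⟩
  rintro rfl
  exact hy.1 (ho.antisymm h hy.2.2)

/-- Deleting a whole subtree creates no new tops: an element below a deleted one is itself deleted.
-/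
theorem IsForestOrder.tops_sdiff_desc_subset (ho : IsForestOrder o) (hSW : S ⊆ W) (hx : x ∈ W) :
    tops o (S \ desc o W x) ⊆ (tops o S).erase x := by
  intro y hy
  obtain ⟨hy, htop⟩ := mem_tops.1 hy
  obtain ⟨hyS, hyx⟩ := Finset.mem_sdiff.1 hy
  refine Finset.mem_erase.2 ⟨?_, mem_tops.2 ⟨hyS, fun z hz hzy => htop z ?_ hzy⟩⟩
  · rintro rfl
    exact hyx (mem_desc.2 ⟨hx, ho.refl _⟩)
  · refine Finset.mem_sdiff.2 ⟨hz, fun hzx => hyx ?_⟩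
    exact mem_desc.2 ⟨hSW hyS, ho.trans (mem_desc.1 hzx).2 hzy⟩

/-- Walking down from heavy vertex to heavy child: `S` is the set of strict descendants of a heavy
vertex, without the subtrees of some light children. -/
theorem learnable_splits_of_few_heavy {e : ℕ} (he : (d + 1) * e < W.card) (n i j : ℕ)
    {C : Set (V → V → Bool)} (S : Finset V) (hC : ∀ o ∈ C, IsTreeOn o W d) (hSW : S ⊆ W)
    (hclosed : ∀ o ∈ C, ∀ x ∈ S, ∀ y ∈ W, o x y = true → y ∈ S)
    (htops : ∀ o ∈ C, (tops o S).card ≤ i) (hS : i * e < S.card)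
    (hheavy : ∀ o ∈ C, (S.filter fun x => W.card < (desc o W x).card + e).card ≤ j)
    (hn : j * (d + 1) + i ≤ n) :
    Learnable (Splits W e) C ((n + 1) * (2 * W.card)) := by
  -- The potential j(d+1) + i falls in each round: a light top lowers i by one, a heavy top lowers j
  -- by one and resets i to d. A round costs |W| to find a top and |W| for its row.
  induction n using Nat.strong_induction_on generalizing C S i j with
  | _ n ih =>
  have hmul : (n + 1) * (2 * W.card) = W.card + (W.card + n * (2 * W.card)) := by ring
  rw [hmul]
  have hScard := Finset.card_le_card hSW
  refine .bind ((Learnable.maximal (Finset.card_pos.1 (by omega))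
    fun o ho => (hC o ho).toIsForestOrder).mono hScard) fun C₁ hC₁ _ ⟨a, ha, hmax⟩ => ?_
  refine .row W a fun C₂ hC₂ ⟨o₀, ho₀⟩ D hDW hD => ?_
  have hC' : ∀ o ∈ C₂, o ∈ C := fun o ho => hC₁ (hC₂ ho)
  have haD : a ∈ D := hD o₀ ho₀ ▸ mem_desc.2 ⟨hSW ha, (hC o₀ (hC' o₀ ho₀)).refl a⟩
  have hDS : D ⊆ S := fun y hy => by
    rw [← hD o₀ ho₀, mem_desc] at hy
    exact hclosed o₀ (hC' o₀ ho₀) a ha y hy.1 hy.2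
  have hatop : ∀ o ∈ C₂, a ∈ tops o S := fun o ho => mem_tops.2 ⟨ha, hmax o (hC₂ ho)⟩
  rcases lt_or_ge D.card e with hlight | hlight
  · obtain ⟨i, rfl⟩ : ∃ k, i = k + 1 := by
      have := (Finset.card_pos.2 ⟨a, hatop o₀ ho₀⟩).trans_le (htops o₀ (hC' o₀ ho₀))
      exact ⟨i - 1, by omega⟩
    obtain ⟨n, rfl⟩ : ∃ k, n = k + 1 := ⟨n - 1, by omega⟩
    refine ih n (by omega) i j (S \ D) (fun o ho => hC o (hC' o ho))
      (Finset.sdiff_subset.trans hSW) (fun o ho x hx y hy hxy => ?_) (fun o ho => ?_) ?_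
      (fun o ho => (Finset.card_le_card ?_).trans (hheavy o (hC' o ho))) (by omega)
    -- A common descendant makes x and a comparable, and a is maximal, so x would lie in the deleted
    -- subtree.
    · obtain ⟨hxS, hxD⟩ := Finset.mem_sdiff.1 hx
      refine Finset.mem_sdiff.2 ⟨hclosed o (hC' o ho) x hxS y hy hxy, fun hyD => ?_⟩
      rw [← hD o ho, mem_desc] at hxD hyD
      have ho' := hC o (hC' o ho)
      rcases ho'.comparable hxy hyD.2 with h | h
      · have := hmax o (hC₂ ho) x hxS h
        exact hxD ⟨hSW hxS, this ▸ ho'.refl _⟩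
      · exact hxD ⟨hSW hxS, h⟩
    · rw [← hD o ho]
      refine (Finset.card_le_card
        ((hC o (hC' o ho)).tops_sdiff_desc_subset hSW (hSW ha))).trans ?_
      rw [Finset.card_erase_of_mem (hatop o ho)]
      have := htops o (hC' o ho)
      omega
    · rw [Finset.card_sdiff_of_subset hDS]
      rw [add_mul] at hS
      omega
    · exact Finset.filter_subset_filter _ Finset.sdiff_subset
  · rcases le_or_gt (D.card + e) W.card with hmid | hmid
    · exact .done fun _ => ⟨a, hSW ha, D, hDW, hlight, hmid, hD⟩
    · have hsub : ∀ o ∈ C₂, ((D.erase a).filter fun x => W.card < (desc o W x).card + e) ⊂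
          S.filter fun x => W.card < (desc o W x).card + e := fun o ho => by
        refine (Finset.ssubset_iff_of_subset (Finset.filter_subset_filter _
          ((Finset.erase_subset _ _).trans hDS))).2 ⟨a, ?_, by simp⟩
        exact Finset.mem_filter.2 ⟨ha, by rwa [hD o ho]⟩
      obtain ⟨j, rfl⟩ : ∃ k, j = k + 1 := by
        have := (Finset.card_lt_card (hsub o₀ ho₀)).trans_le (hheavy o₀ (hC' o₀ ho₀))
        exact ⟨j - 1, by omega⟩
      rw [add_mul] at hn he
      obtain ⟨n, rfl⟩ : ∃ k, n = k + 1 := ⟨n - 1, by omega⟩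
      refine ih n (by omega) d j (D.erase a) (fun o ho => hC o (hC' o ho))
        ((Finset.erase_subset _ _).trans hDW) (fun o ho x hx y hy hxy => ?_) (fun o ho => ?_) ?_
        (fun o ho => ?_) (by omega)
      · rw [← hD o ho] at hx ⊢
        exact (hC o (hC' o ho)).strictDesc_closed hx hy hxy
      · rw [← hD o ho]
        exact (hC o (hC' o ho)).degree a (hSW ha)
      · rw [Finset.card_erase_of_mem haD]
        omega
      · have := (Finset.card_lt_card (hsub o ho)).trans_le (hheavy o (hC' o ho))
        omega

end Order

/-! ### The accelerated search for a splitting vertex -/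

section Search

variable {V : Type*} [DecidableEq V]

/-- The vertices of `U` with at least `t` known descendants in `U`, where `out x` is the set of
known descendants of `x`. -/
def live (out : V → Finset V) (t : ℕ) (U : Finset V) : Finset V :=
  U.filter fun x => t ≤ (out x ∩ U).card

theorem mem_live {out : V → Finset V} {t : ℕ} {U : Finset V} {x : V} :
    x ∈ live out t U ↔ x ∈ U ∧ t ≤ (out x ∩ U).card := Finset.mem_filter

theorem live_mono {out : V → Finset V} {t : ℕ} {U U' : Finset V} (h : U ⊆ U') :
    live out t U ⊆ live out t U' := fun _ hx =>
  mem_live.2 ⟨h (mem_live.1 hx).1,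
    (mem_live.1 hx).2.trans (Finset.card_le_card (Finset.inter_subset_inter_left h))⟩

/-- The knowledge during the search for a splitting vertex: `S` is the set of strict descendants
of a heavy vertex, `R` is a union of light subtrees, and `X` lists heavy vertices found so far. -/
structure IsSearchState (W : Finset V) (d e t : ℕ) (nb out : V → Finset V)
    (C : Set (V → V → Bool)) (S R : Finset V) (X : List V) : Prop where
  isTreeOn : ∀ o ∈ C, IsTreeOn o W d
  out_eq : ∀ o ∈ C, ∀ x ∈ W, desc o (nb x) x = out x
  subset : S ⊆ W
  le_card : W.card ≤ S.card + e
  closed : ∀ o ∈ C, ∀ x ∈ S, ∀ y ∈ W, o x y = true → y ∈ S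
  card_tops : ∀ o ∈ C, (tops o S).card ≤ d
  removed_subset : R ⊆ W
  removed_light : ∀ o ∈ C, ∀ x ∈ R, (desc o W x).card < e
  removed_closed : ∀ o ∈ C, ∀ x ∈ R, ∀ y ∈ W, o x y = true → y ∈ R
  removed_known : ∀ o ∈ C, ∀ o' ∈ C, ∀ z ∈ S \ R, desc o R z = desc o' R z
  found_subset : ∀ x ∈ X, x ∈ W
  found_notMem : ∀ x ∈ X, x ∉ S
  found_pairwise : X.Pairwise fun x y => x ≠ y ∧ y ∉ nb x
  found_live : ∀ x ∈ X, ∀ y ∈ live out t (S \ R), y ∉ nb x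

namespace IsSearchState

variable {W : Finset V} {d e t : ℕ} {nb out : V → Finset V} {C C' : Set (V → V → Bool)}
  {S R D : Finset V} {X : List V} {x : V}

theorem desc_subset_of_mem (h : IsSearchState W d e t nb out C S R X) {o : V → V → Bool}
    (ho : o ∈ C) (hx : x ∈ S) : desc o W x ⊆ S := fun y hy =>
  h.closed o ho x hx y (mem_desc.1 hy).1 (mem_desc.1 hy).2

theorem descend (h : IsSearchState W d e t nb out C S R X) (hC' : C' ⊆ C) (hne : C'.Nonempty)
    (hx : x ∈ S) (hD : ∀ o ∈ C', desc o W x = D) (hheavy : W.card < D.card + e) :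
    IsSearchState W d e t nb out C' (D.erase x) R X := by
  obtain ⟨o₀, ho₀⟩ := hne
  have hDS : D ⊆ S := hD o₀ ho₀ ▸ h.desc_subset_of_mem (hC' ho₀) hx
  have hsub : D.erase x ⊆ S := (Finset.erase_subset _ _).trans hDS
  exact {
    isTreeOn := fun o ho => h.isTreeOn o (hC' ho)
    out_eq := fun o ho => h.out_eq o (hC' ho)
    subset := hsub.trans h.subset
    le_card := by
      have := Finset.pred_card_le_card_erase (s := D) (a := x)
      omega
    closed := fun o ho y hy z hz hyz => by
      rw [← hD o ho] at hy ⊢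
      exact (h.isTreeOn o (hC' ho)).strictDesc_closed hy hz hyz
    card_tops := fun o ho => by
      rw [← hD o ho]
      exact (h.isTreeOn o (hC' ho)).degree x (h.subset hx)
    removed_subset := h.removed_subset
    removed_light := fun o ho => h.removed_light o (hC' ho)
    removed_closed := fun o ho => h.removed_closed o (hC' ho)
    removed_known := fun o ho o' ho' z hz => h.removed_known o (hC' ho) o' (hC' ho') z
      (Finset.sdiff_subset_sdiff hsub subset_rfl hz)
    found_subset := h.found_subset
    found_notMem := fun y hy hy' => h.found_notMem y hy (hsub hy')
    found_pairwise := h.found_pairwise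
    found_live := fun y hy z hz => h.found_live y hy z
      (live_mono (Finset.sdiff_subset_sdiff hsub subset_rfl) hz) }

theorem append (h : IsSearchState W d e t nb out C S R X) (hx : x ∈ W) (hxS : x ∉ S)
    (hX : ∀ y ∈ X, x ≠ y ∧ x ∉ nb y) (hlive : ∀ y ∈ live out t (S \ R), y ∉ nb x) :
    IsSearchState W d e t nb out C S R (X ++ [x]) :=
  { h with
    found_subset := by
      simp only [List.mem_append, List.mem_singleton]
      rintro y (hy | rfl)
      exacts [h.found_subset y hy, hx]
    found_notMem := by
      simp only [List.mem_append, List.mem_singleton]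
      rintro y (hy | rfl)
      exacts [h.found_notMem y hy, hxS]
    found_pairwise := by
      refine List.pairwise_append.2 ⟨h.found_pairwise, List.pairwise_singleton _ _, ?_⟩
      intro y hy z hz
      rw [List.mem_singleton.1 hz]
      exact ⟨(hX y hy).1.symm, (hX y hy).2⟩
    found_live := by
      simp only [List.mem_append, List.mem_singleton]
      rintro y (hy | rfl)
      exacts [h.found_live y hy, hlive] }

/-- The column of x is what keeps `removed_known` true: a vertex outside R ∪ D reaches all of D or
none of it, according to whether it reaches x. -/
theorem remove (h : IsSearchState W d e t nb out C S R X) (hC' : C' ⊆ C)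
    (hD : ∀ o ∈ C', desc o W x = D) (hlight : D.card < e) (hDW : D ⊆ W)
    (hcol : ∀ o ∈ C', ∀ o' ∈ C', ∀ y ∈ W, o y x = o' y x) :
    IsSearchState W d e t nb out C' S (R ∪ D) X :=
  { isTreeOn := fun o ho => h.isTreeOn o (hC' ho)
    out_eq := fun o ho => h.out_eq o (hC' ho)
    subset := h.subset
    le_card := h.le_card
    closed := fun o ho => h.closed o (hC' ho)
    card_tops := fun o ho => h.card_tops o (hC' ho)
    removed_subset := Finset.union_subset h.removed_subset hDW
    removed_light := fun o ho y hy => by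
      rcases Finset.mem_union.1 hy with hy | hy
      · exact h.removed_light o (hC' ho) y hy
      · rw [← hD o ho] at hy hlight
        exact (Finset.card_le_card ((h.isTreeOn o (hC' ho)).desc_subset_desc
          (mem_desc.1 hy).2)).trans_lt hlight
    removed_closed := fun o ho y hy z hz hyz => by
      rcases Finset.mem_union.1 hy with hy | hy
      · exact Finset.mem_union_left _ (h.removed_closed o (hC' ho) y hy z hz hyz)
      · rw [← hD o ho] at hy ⊢
        exact Finset.mem_union_right _ (mem_desc.2 ⟨hz,
          (h.isTreeOn o (hC' ho)).trans (mem_desc.1 hy).2 hyz⟩)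
    removed_known := by
      have key : ∀ o ∈ C', ∀ z ∈ S \ (R ∪ D),
          desc o (R ∪ D) z = desc o R z ∪ if o z x = true then D else ∅ := by
        intro o ho z hz
        have ho' := h.isTreeOn o (hC' ho)
        simp only [Finset.mem_sdiff, Finset.mem_union, not_or] at hz
        ext y
        simp only [Finset.mem_union, mem_desc]
        by_cases hzx : o z x = true
        · rw [if_pos hzx]
          constructor
          · tauto
          · rintro (hy | hy)
            · tauto
            · refine ⟨Or.inr hy, ho'.trans hzx ?_⟩
              rw [← hD o ho, mem_desc] at hy
              exact hy.2
        · rw [if_neg hzx]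
          simp only [Finset.notMem_empty, or_false]
          refine ⟨fun ⟨hy, hzy⟩ => ⟨hy.resolve_right fun hyD => ?_, hzy⟩, by tauto⟩
          rw [← hD o ho, mem_desc] at hyD
          rcases ho'.comparable hzy hyD.2 with hzx' | hxz
          · exact hzx hzx'
          · refine hz.2.2 ?_
            rw [← hD o ho]
            exact mem_desc.2 ⟨h.subset hz.1, hxz⟩
      intro o ho o' ho' z hz
      have hz' : z ∈ S \ R := Finset.sdiff_subset_sdiff subset_rfl Finset.subset_union_left hz
      rw [key o ho z hz, key o' ho' z hz, h.removed_known o (hC' ho) o' (hC' ho') z hz',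
        hcol o ho o' ho' z (h.subset (Finset.mem_sdiff.1 hz).1)]
    found_subset := h.found_subset
    found_notMem := h.found_notMem
    found_pairwise := h.found_pairwise
    found_live := fun y hy z hz => h.found_live y hy z
      (live_mono (Finset.sdiff_subset_sdiff subset_rfl Finset.subset_union_left) hz) }

/-- Otherwise the first K entries and the remaining ones are two sets of size at least K with no
sampled pair from the former to the latter. -/
theorem length_lt {K : ℕ} (h : IsSearchState W d e t nb out C S R X)
    (hnb : ∀ A ⊆ W, ∀ B ⊆ W, K ≤ A.card → K ≤ B.card → ∃ a ∈ A, ∃ b ∈ B, b ∈ nb a) :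
    X.length < 2 * K := by
  by_contra! hK
  have hsplit := h.found_pairwise
  rw [← List.take_append_drop K X, List.pairwise_append] at hsplit
  obtain ⟨h₁, h₂, h₁₂⟩ := hsplit
  obtain ⟨a, ha, b, hb, hab⟩ := hnb (X.take K).toFinset (fun x hx => h.found_subset x
      (List.mem_of_mem_take (List.mem_toFinset.1 hx))) (X.drop K).toFinset (fun x hx =>
      h.found_subset x (List.mem_of_mem_drop (List.mem_toFinset.1 hx)))
    (by rw [List.toFinset_card_of_nodup (h₁.imp fun h => h.1), List.length_take]; omega)
    (by rw [List.toFinset_card_of_nodup (h₂.imp fun h => h.1), List.length_drop]; omega)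
  exact (h₁₂ a (List.mem_toFinset.1 ha) b (List.mem_toFinset.1 hb)).2 hab

/-- Heavy vertices form a chain, so K of them lie above the lowest one, z. None is live, so together
they have at most Kt sampled pairs into the remaining subtree of z. That subtree has more than |W| -
2e elements, so K of them are missed by all these pairs, against the choice of the sample. -/
theorem card_heavy_lt {K : ℕ} (h : IsSearchState W d e t nb out C S R X)
    {o : V → V → Bool} (ho : o ∈ C)
    (hnb : ∀ A ⊆ W, ∀ B ⊆ W, K ≤ A.card → K ≤ B.card → ∃ a ∈ A, ∃ b ∈ B, b ∈ nb a)
    (he : 2 * e + (K * t + K) ≤ W.card) (hsmall : ∀ z ∈ S \ R, (desc o R z).card < e)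
    (hlive : live out t (S \ R) = ∅) :
    (S.filter fun x => W.card < (desc o W x).card + e).card < K + 1 := by
  by_contra! hK
  set H := S.filter fun x => W.card < (desc o W x).card + e with hH
  have ho' := h.isTreeOn o ho
  obtain ⟨z, hzH, hzmin⟩ := H.exists_min_image (fun x => (desc o W x).card)
    (Finset.card_pos.1 (by omega))
  have hHS : ∀ a ∈ H, a ∈ S := fun a ha => (Finset.mem_filter.1 ha).1
  have hHR : ∀ a ∈ H, a ∉ R := fun a ha haR => by
    have h₁ := h.removed_light o ho a haR
    have h₂ := (Finset.mem_filter.1 ha).2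
    omega
  -- Two heavy subtrees intersect because 2e ≤ |W|; a common descendant makes their roots
  -- comparable.
  have hlow : ∀ a ∈ H, o a z = true := by
    intro a ha
    have hcard : W.card < (desc o W a).card + (desc o W z).card := by
      have h₁ := (Finset.mem_filter.1 ha).2
      have h₂ := (Finset.mem_filter.1 hzH).2
      omega
    obtain ⟨y, hy⟩ := Finset.inter_nonempty_of_card_lt_card_add_card desc_subset desc_subset hcard
    obtain ⟨hya, hyz⟩ := Finset.mem_inter.1 hy
    rcases ho'.comparable (mem_desc.1 hya).2 (mem_desc.1 hyz).2 with haz | hza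
    · exact haz
    · have := Finset.eq_of_subset_of_card_le (ho'.desc_subset_desc hza) (hzmin a ha)
      have hz : z ∈ desc o W z := mem_desc.2 ⟨h.subset (hHS z hzH), ho'.refl z⟩
      rw [← this] at hz
      exact (mem_desc.1 hz).2
  obtain ⟨A, hAH, hA⟩ := Finset.exists_subset_card_eq (s := H) (n := K) (by omega)
  have hzR : (desc o W z \ R).card + e ≥ (desc o W z).card := by
    have h₁ := hsmall z (Finset.mem_sdiff.2 ⟨hHS z hzH, hHR z hzH⟩)
    have h₂ : (desc o W z ∩ R).card ≤ (desc o R z).card := Finset.card_le_card fun y hy => by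
      simp only [Finset.mem_inter, mem_desc] at hy ⊢
      tauto
    have h₃ := Finset.card_sdiff_add_card_inter (desc o W z) R
    omega
  have hfew : ∀ a ∈ A, (nb a ∩ (desc o W z \ R)).card ≤ t := by
    intro a ha
    have haS := hHS a (hAH ha)
    have hnl : a ∉ live out t (S \ R) := by simp [hlive]
    rw [mem_live, not_and, not_le] at hnl
    refine (Finset.card_le_card fun y hy => ?_).trans
      (hnl (Finset.mem_sdiff.2 ⟨haS, hHR a (hAH ha)⟩)).le
    simp only [Finset.mem_inter, Finset.mem_sdiff] at hy ⊢
    have hay := ho'.trans (hlow a (hAH ha)) (mem_desc.1 hy.2.1).2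
    refine ⟨?_, h.desc_subset_of_mem ho (hHS z hzH) hy.2.1, hy.2.2⟩
    rw [← h.out_eq o ho a (h.subset haS)]
    exact mem_desc.2 ⟨hy.1, hay⟩
  have hUnion := Finset.card_biUnion_le_card_mul A (fun a => nb a ∩ (desc o W z \ R)) t hfew
  have hB := Finset.le_card_sdiff (A.biUnion fun a => nb a ∩ (desc o W z \ R)) (desc o W z \ R)
  have hz := (Finset.mem_filter.1 hzH).2
  rw [hA] at hUnion
  obtain ⟨a, ha, b, hb, hab⟩ := hnb A (fun a ha => h.subset (hHS a (hAH ha)))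
    ((desc o W z \ R) \ A.biUnion fun a => nb a ∩ (desc o W z \ R))
    (Finset.sdiff_subset.trans (Finset.sdiff_subset.trans desc_subset)) hA.ge (by omega)
  obtain ⟨hb₁, hb₂⟩ := Finset.mem_sdiff.1 hb
  exact hb₂ (Finset.mem_biUnion.2 ⟨a, ha, Finset.mem_inter.2 ⟨hab, hb₁⟩⟩)

/-- The potential counts units of |W| queries: one for each heavy vertex still to be found, four for
each possible deletion of t vertices. The bound `hsmall` is not part of `IsSearchState` because a
deletion may break it; a descent then restores it, or a split is found. -/
theorem learnable_splits {K : ℕ} (n : ℕ) (h : IsSearchState W d e t nb out C S R X)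
    (hnb : ∀ A ⊆ W, ∀ B ⊆ W, K ≤ A.card → K ≤ B.card → ∃ a ∈ A, ∃ b ∈ B, b ∈ nb a)
    (hnbW : ∀ x, nb x ⊆ W) (hde : (d + 1) * e < W.card) (he : 2 * e + (K * t + K) ≤ W.card)
    (ht : 0 < t) (hsmall : ∀ o ∈ C, ∀ z ∈ S \ R, (desc o R z).card < e)
    (hn : 2 * K - X.length + 4 * ((S \ R).card / t) ≤ n) :
    Learnable (Splits W e) C (n * W.card + (K * (d + 1) + d + 1) * (2 * W.card)) := by
  induction n using Nat.strong_induction_on generalizing C S R X with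
  | _ n ih =>
  refine .of_nonempty fun ⟨o₀, ho₀⟩ => ?_
  rcases (live out t (S \ R)).eq_empty_or_nonempty with hlive | hlive
  · refine (learnable_splits_of_few_heavy hde (K * (d + 1) + d) d K S h.isTreeOn h.subset h.closed
      h.card_tops ?_ (fun o ho => Nat.lt_succ_iff.1
        (h.card_heavy_lt ho hnb he (hsmall o ho) hlive)) le_rfl).mono (by omega)
    have := h.le_card
    rw [add_mul] at hde
    omega
  -- The set `out` is the same for all consistent oracles, so any one of them, here o₀, may be used
  -- to choose x.
  obtain ⟨x, hx, hsink⟩ : ∃ x ∈ live out t (S \ R), ∀ y ∈ live out t (S \ R), y ≠ x →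
      y ∉ out x := by
    obtain ⟨x, hx, hmin⟩ := (live out t (S \ R)).exists_min_image
      (fun x => (desc o₀ W x).card) hlive
    refine ⟨x, hx, fun y hy hyx hout => hyx ?_⟩
    have hyS := (Finset.mem_sdiff.1 (mem_live.1 hy).1).1
    have hxS := (Finset.mem_sdiff.1 (mem_live.1 hx).1).1
    have ho' := h.isTreeOn o₀ ho₀
    rw [← h.out_eq o₀ ho₀ x (h.subset hxS)] at hout
    have hxy := (mem_desc.1 hout).2
    have := Finset.eq_of_subset_of_card_le (ho'.desc_subset_desc hxy) (hmin y hy)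
    have hx' : x ∈ desc o₀ W x := mem_desc.2 ⟨h.subset hxS, ho'.refl x⟩
    rw [← this] at hx'
    exact ho'.antisymm (mem_desc.1 hx').2 hxy
  obtain ⟨hxSR, hxt⟩ := mem_live.1 hx
  obtain ⟨hxS, hxR⟩ := Finset.mem_sdiff.1 hxSR
  have hquot : 1 ≤ (S \ R).card / t := (Nat.one_le_div_iff ht).2
    (hxt.trans (Finset.card_le_card Finset.inter_subset_right))
  obtain ⟨n, rfl⟩ : ∃ k, n = k + 4 := ⟨n - 4, by omega⟩
  refine (Learnable.row W x (q := 3 * W.card + (n * W.card + (K * (d + 1) + d + 1) *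
    (2 * W.card))) fun C₁ hC₁ hne₁ D hDW hD => ?_).mono (by linarith)
  rcases lt_or_ge D.card e with hlight | hlight
  · refine (Learnable.column W x (q := 2 * W.card + (n * W.card + (K * (d + 1) + d + 1) *
      (2 * W.card))) fun C₂ hC₂ hne₂ hcol => ?_).mono (by linarith)
    have h₂ := h.remove (hC₂.trans hC₁) (fun o ho => hD o (hC₂ ho)) hlight hDW hcol
    obtain ⟨o₂, ho₂⟩ := hne₂
    have hcard : (S \ (R ∪ D)).card + t ≤ (S \ R).card := by
      have h₃ : out x ∩ (S \ R) ⊆ D := fun y hy => by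
        have hy := (Finset.mem_inter.1 hy).1
        rw [← h.out_eq o₂ (hC₁ (hC₂ ho₂)) x (h.subset hxS), mem_desc] at hy
        rw [← hD o₂ (hC₂ ho₂), mem_desc]
        exact ⟨hnbW x hy.1, hy.2⟩
      have h₄ : S \ (R ∪ D) ⊆ (S \ R) \ (out x ∩ (S \ R)) := fun y hy => by
        simp only [Finset.mem_sdiff, Finset.mem_union, not_or] at hy ⊢
        exact ⟨⟨hy.1, hy.2.1⟩, fun hy' => hy.2.2 (h₃ hy')⟩
      have h₅ := Finset.card_le_card h₄
      rw [Finset.card_sdiff_of_subset Finset.inter_subset_right] at h₅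
      have h₆ := Finset.card_le_card (Finset.inter_subset_right : out x ∩ (S \ R) ⊆ S \ R)
      omega
    have hdiv : (S \ (R ∪ D)).card / t + 1 ≤ (S \ R).card / t := by
      rw [← Nat.add_div_right _ ht]
      exact Nat.div_le_div_right hcard
    -- Y collects the violations of `hsmall`. By `removed_known` it does not depend on the oracle,
    -- so a lowest element y can be sought by queries. Having e deleted descendants, y is not light:
    -- it splits, or the search moves strictly below it, where Y has no element.
    set Y := (S \ (R ∪ D)).filter fun z => e ≤ (desc o₂ (R ∪ D) z).card with hY
    have hYmem : ∀ o ∈ C₂, ∀ z ∈ S \ (R ∪ D), z ∉ Y → (desc o (R ∪ D) z).card < e := by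
      intro o ho z hz hzY
      rw [h₂.removed_known o ho o₂ ho₂ z hz]
      by_contra! hge
      exact hzY (Finset.mem_filter.2 ⟨hz, hge⟩)
    rcases Y.eq_empty_or_nonempty with hYe | hYne
    · refine (ih n (by omega) h₂ (fun o ho z hz => hYmem o ho z hz (by simp [hYe]))
        (by omega)).mono (by omega)
    refine (Learnable.bind (q' := W.card + (n * W.card + (K * (d + 1) + d + 1) * (2 * W.card)))
      ((Learnable.minimal hYne fun o ho =>
        (h₂.isTreeOn o ho).toIsForestOrder).mono (Finset.card_le_card (t := W) ?_))
      fun C₃ hC₃ hne₃ ⟨y, hy, hmin⟩ => .row W y fun C₄ hC₄ hne₄ D' hD'W hD' => ?_).mono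
      (by linarith)
    · exact (Finset.filter_subset _ _).trans (Finset.sdiff_subset.trans h.subset)
    have hyS : y ∈ S := (Finset.mem_sdiff.1 (Finset.mem_filter.1 hy).1).1
    rcases le_or_gt (D'.card + e) W.card with hmid | hheavy
    · refine .done fun ⟨o, ho⟩ => ⟨y, h.subset hyS, D', hD'W, ?_, hmid, hD'⟩
      refine (Finset.mem_filter.1 hy).2.trans ?_
      rw [h₂.removed_known o₂ ho₂ o (hC₃ (hC₄ ho)) y (Finset.mem_filter.1 hy).1, ← hD' o ho]
      exact Finset.card_le_card (Finset.filter_subset_filter _ h₂.removed_subset)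
    · have h₄ := h₂.descend (hC₄.trans hC₃) hne₄ hyS hD' hheavy
      obtain ⟨o₄, ho₄⟩ := hne₄
      have hsub : D'.erase y ⊆ S := by
        rw [← hD' o₄ ho₄]
        exact (Finset.erase_subset _ _).trans
          (h₂.desc_subset_of_mem (hC₃ (hC₄ ho₄)) hyS)
      refine ih n (by omega) h₄ (fun o ho z hz => ?_) ?_
      · refine hYmem o (hC₃ (hC₄ ho)) z (Finset.sdiff_subset_sdiff hsub subset_rfl hz) fun hzY => ?_
        obtain ⟨hzy, hzD⟩ := Finset.mem_erase.1 (Finset.mem_sdiff.1 hz).1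
        rw [← hD' o ho] at hzD
        exact hzy (hmin o (hC₄ ho) z hzY (mem_desc.1 hzD).2)
      · have := Nat.div_le_div_right (c := t)
          (Finset.card_le_card (Finset.sdiff_subset_sdiff hsub (subset_refl (R ∪ D))))
        omega
  · rcases le_or_gt (D.card + e) W.card with hmid | hheavy
    · exact .done fun _ => ⟨x, h.subset hxS, D, hDW, hlight, hmid, hD⟩
    · have h₁ := h.descend hC₁ hne₁ hxS hD hheavy
      obtain ⟨o₁, ho₁⟩ := hne₁
      have hsub : D.erase x ⊆ S := by
        rw [← hD o₁ ho₁]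
        exact (Finset.erase_subset _ _).trans (h.desc_subset_of_mem (hC₁ ho₁) hxS)
      have hsub' := Finset.sdiff_subset_sdiff hsub (subset_refl R)
      have h₂ := h₁.append (x := x) (h.subset hxS) (by simp)
        (fun y hy => ⟨fun hxy => h.found_notMem y hy (hxy ▸ hxS), h.found_live y hy x hx⟩)
        -- Every remaining vertex lies below x, so a live one in `nb x` would be a known descendant
        -- of x, contrary to the choice of x.
        (fun y hy hyx => by
          have hyD := Finset.mem_erase.1 (Finset.mem_sdiff.1 (mem_live.1 hy).1).1
          refine hsink y (live_mono hsub' hy) hyD.1 ?_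
          rw [← h.out_eq o₁ (hC₁ ho₁) x (h.subset hxS), mem_desc]
          rw [← hD o₁ ho₁, mem_desc] at hyD
          exact ⟨hyx, hyD.2.2⟩)
      have hlen := h₂.length_lt hnb
      have hdiv := Nat.div_le_div_right (c := t) (Finset.card_le_card hsub')
      rw [List.length_append, List.length_singleton] at hlen
      refine (ih (n + 3) (by omega) h₂ (fun o ho z hz => hsmall o (hC₁ ho) z (hsub' hz)) ?_).mono
        (by linarith)
      rw [List.length_append, List.length_singleton]
      omega

end IsSearchState

end Search

/-! ### Sparse samples meeting all pairs of large sets -/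

/-- By counting, `s` out-neighbours can be chosen for each element of `α` so that there is an edge
from each set of size `K` to each set of size `K`. -/
theorem exists_neighbors_meeting_large_sets {α : Type*} [Fintype α] [DecidableEq α] {K s : ℕ}
    (hK : K ≤ Fintype.card α)
    (h : (Fintype.card α ^ K * Fintype.card α ^ K) * (Fintype.card α - K) ^ (K * s) <
      Fintype.card α ^ (K * s)) :
    ∃ g : α × Fin s → α, ∀ A B : Finset α, K ≤ A.card → K ≤ B.card →
      ∃ a ∈ A, ∃ i, g (a, i) ∈ B := by
  set m := Fintype.card α with hm
  have hm0 : 0 < m ^ ((m - K) * s) := by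
    rcases Nat.eq_zero_or_pos m with h0 | h0
    · simp [h0]
    · exact pow_pos h0 _
  -- Union bound over pairs (A, B) of K-sets: the bad choices send every out-neighbour of A outside
  -- B.
  let bad : Finset α × Finset α → Finset (α × Fin s → α) := fun P =>
    Fintype.piFinset fun p => if p.1 ∈ P.1 then P.2ᶜ else Finset.univ
  let I := (Finset.univ.powersetCard K : Finset (Finset α)) ×ˢ
    (Finset.univ.powersetCard K : Finset (Finset α))
  have hbad : ∀ P ∈ I, (bad P).card ≤ (m - K) ^ (K * s) * m ^ ((m - K) * s) := by
    intro P hP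
    obtain ⟨hA, hB⟩ := Finset.mem_product.1 hP
    have hA := (Finset.mem_powersetCard.1 hA).2
    have hB := (Finset.mem_powersetCard.1 hB).2
    have h₁ : ∀ p : α × Fin s, (if p.1 ∈ P.1 then P.2ᶜ else Finset.univ : Finset α).card =
        if p.1 ∈ P.1 then m - K else m := fun p => by
      split_ifs
      · rw [Finset.card_compl, hB]
      · exact Finset.card_univ
    have h₂ : (Finset.univ.filter fun x => x ∉ P.1).card = m - K := by
      rw [← hA, hm, ← Finset.card_compl]
      congr 1
      ext x
      simp
    refine le_of_eq ?_
    simp only [bad, Fintype.card_piFinset, h₁]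
    rw [Fintype.prod_prod_type]
    have h₃ : ∀ x : α, ∏ _i : Fin s, (if x ∈ P.1 then m - K else m) =
        (if x ∈ P.1 then m - K else m) ^ s := fun x => by simp
    rw [Finset.prod_congr rfl fun x _ => h₃ x, Finset.prod_pow, Finset.prod_ite,
      Finset.prod_const, Finset.prod_const, h₂,
      Finset.filter_mem_eq_inter, Finset.univ_inter, hA, mul_pow, ← pow_mul, ← pow_mul]
  have hcard : (I.biUnion bad).card < (Finset.univ : Finset (α × Fin s → α)).card := by
    have hI : I.card ≤ m ^ K * m ^ K := by
      rw [Finset.card_product, Finset.card_powersetCard, Finset.card_univ]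
      exact Nat.mul_le_mul (Nat.choose_le_pow _ _) (Nat.choose_le_pow _ _)
    calc (I.biUnion bad).card
        ≤ I.card * ((m - K) ^ (K * s) * m ^ ((m - K) * s)) :=
          Finset.card_biUnion_le_card_mul _ _ _ hbad
      _ ≤ (m ^ K * m ^ K) * ((m - K) ^ (K * s) * m ^ ((m - K) * s)) := Nat.mul_le_mul_right _ hI
      _ = ((m ^ K * m ^ K) * (m - K) ^ (K * s)) * m ^ ((m - K) * s) := by ring
      _ < m ^ (K * s) * m ^ ((m - K) * s) := Nat.mul_lt_mul_of_pos_right h hm0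
      _ = (Finset.univ : Finset (α × Fin s → α)).card := by
        rw [← pow_add, ← add_mul, Nat.add_sub_cancel' hK, Finset.card_univ, Fintype.card_fun,
          Fintype.card_prod, Fintype.card_fin]
  obtain ⟨g, -, hg⟩ := Finset.exists_mem_notMem_of_card_lt_card hcard
  refine ⟨g, fun A B hA hB => ?_⟩
  obtain ⟨A', hA', hAK⟩ := Finset.exists_subset_card_eq hA
  obtain ⟨B', hB', hBK⟩ := Finset.exists_subset_card_eq hB
  by_contra! hne
  refine hg (Finset.mem_biUnion.2 ⟨(A', B'), ?_, Fintype.mem_piFinset.2 fun p => ?_⟩)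
  · simp [I, Finset.mem_powersetCard, hAK, hBK]
  · split_ifs with hp
    · exact Finset.mem_compl.2 fun hgB => hne p.1 (hA' hp) p.2 (hB' hgB)
    · exact Finset.mem_univ _

/-- Since 1 - K/m ≤ exp(-K/m), the ratio of the two sides is at most exp(2K log m - K²s/m) < 1. -/
theorem pow_mul_sub_pow_lt {m K s : ℕ} (hK0 : 0 < K) (hK : K ≤ m)
    (h : 2 * m * Real.log m < K * s) :
    (m ^ K * m ^ K) * (m - K) ^ (K * s) < m ^ (K * s) := by
  have hm : (0 : ℝ) < m := by exact_mod_cast hK0.trans_le hK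
  have hK0' : (0 : ℝ) < K := by exact_mod_cast hK0
  have h₁ : ((m : ℝ) - K) ≤ m * Real.exp (-(K / m)) := by
    have := Real.add_one_le_exp (-((K : ℝ) / m))
    calc (m : ℝ) - K = m * (-(K / m) + 1) := by field_simp; ring
      _ ≤ _ := by gcongr
  have h₂ : ((m : ℝ) - K) ^ (K * s) ≤ m ^ (K * s) * Real.exp (-(K / m) * (K * s)) := by
    calc ((m : ℝ) - K) ^ (K * s) ≤ (m * Real.exp (-(K / m))) ^ (K * s) :=
          pow_le_pow_left₀ (by simpa using hK) h₁ _
      _ = _ := by rw [mul_pow, ← Real.exp_nat_mul]; push_cast; ring_nf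
  have h₃ : (m : ℝ) ^ K * m ^ K = Real.exp (2 * K * Real.log m) := by
    rw [← Real.exp_log hm, ← Real.exp_nat_mul, ← Real.exp_add, Real.log_exp]
    ring_nf
  have h₄ : 2 * K * Real.log m + -(K / m) * (K * s) < 0 := by
    have : 2 * K * Real.log m + -((K : ℝ) / m) * (K * s) =
        (K / m) * (2 * m * Real.log m - K * s) := by field_simp; ring
    rw [this]
    exact mul_neg_of_pos_of_neg (by positivity) (by linarith)
  have : ((m : ℝ) ^ K * m ^ K) * (m - K) ^ (K * s) < m ^ (K * s) := by
    rw [h₃]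
    calc _ ≤ Real.exp (2 * K * Real.log m) * (m ^ (K * s) * Real.exp (-(K / m) * (K * s))) := by
          gcongr
      _ = m ^ (K * s) * Real.exp (2 * K * Real.log m + -(K / m) * (K * s)) := by
          rw [Real.exp_add]; ring
      _ < m ^ (K * s) * 1 := by
          gcongr
          exact Real.exp_zero ▸ Real.exp_lt_exp.2 h₄
      _ = _ := mul_one _
  rw [← Nat.cast_sub hK] at this
  exact_mod_cast this

theorem exists_sparse_neighbors {V : Type*} [DecidableEq V] (W : Finset V) {K s : ℕ}
    (hK0 : 0 < K) (hK : K ≤ W.card) (h : 2 * W.card * Real.log W.card < K * s) :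
    ∃ nb : V → Finset V, (∀ x, nb x ⊆ W) ∧ (∀ x, (nb x).card ≤ s) ∧
      ∀ A ⊆ W, ∀ B ⊆ W, K ≤ A.card → K ≤ B.card → ∃ a ∈ A, ∃ b ∈ B, b ∈ nb a := by
  obtain ⟨g, hg⟩ := exists_neighbors_meeting_large_sets (α := W) (K := K) (s := s)
    (by simpa using hK) (by simpa using pow_mul_sub_pow_lt hK0 hK h)
  refine ⟨fun x => if hx : x ∈ W then
    Finset.univ.image fun i => (g (⟨x, hx⟩, i) : V) else ∅, fun x => ?_, fun x => ?_,
    fun A hA B hB hAK hBK => ?_⟩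
  · dsimp only
    split_ifs
    · intro y hy
      obtain ⟨i, -, rfl⟩ := Finset.mem_image.1 hy
      exact Subtype.coe_prop _
    · simp
  · dsimp only
    split_ifs
    · exact Finset.card_image_le.trans (by simp)
    · simp
  · have hcard : ∀ A ⊆ W, (A.subtype (· ∈ W)).card = A.card := fun A hA => by
      rw [Finset.card_subtype, Finset.filter_true_of_mem fun x hx => hA hx]
    obtain ⟨a, ha, i, hi⟩ := hg (A.subtype (· ∈ W)) (B.subtype (· ∈ W))
      (by rwa [hcard A hA]) (by rwa [hcard B hB])
    rw [Finset.mem_subtype] at ha hi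
    refine ⟨a, ha, _, hi, ?_⟩
    simp

/-! ### Choice of parameters and divide and conquer -/

section Recursion

variable {V : Type*} [DecidableEq V] {W : Finset V} {d : ℕ} {C : Set (V → V → Bool)}

theorem learnable_splits {K : ℕ} (hC : ∀ o ∈ C, IsTreeOn o W d) (hK0 : 0 < K)
    (hK : 4 * K ≤ W.card) (hd : 8 * (d + 1) ≤ W.card)
    (hlog : 2 * W.card * Real.log W.card < K * K) :
    Learnable (Splits W (W.card / (8 * (d + 1)))) C (W.card * K * (40 + 4 * d)) := by
  set m := W.card with hm
  set e := m / (8 * (d + 1)) with he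
  set t := m / (4 * K) with ht
  have he0 : 0 < e := Nat.div_pos hd (by omega)
  have hem : e * (8 * (d + 1)) ≤ m := Nat.div_mul_le_self _ _
  have ht0 : 0 < t := Nat.div_pos hK (by omega)
  have htm : t * (4 * K) ≤ m := Nat.div_mul_le_self _ _
  have hmt : m / t ≤ 8 * K := by
    have h₁ : m < 4 * K * (t + 1) := Nat.lt_mul_div_succ m (by omega)
    refine (Nat.div_le_iff_le_mul_add_pred ht0).2 ?_
    nlinarith
  obtain ⟨nb, hnbW, hnbK, hnb⟩ := exists_sparse_neighbors W hK0 (by omega) hlog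
  have hWne : W.Nonempty := Finset.card_pos.1 (by omega)
  refine (Learnable.bind (q' := m * K + ((34 * K) * m + (K * (d + 1) + d + 1) * (2 * m)))
    (Learnable.maximal hWne fun o ho => (hC o ho).toIsForestOrder)
    fun C₁ hC₁ _ ⟨r, hr, hmax⟩ => ?_).mono ?_
  · have hcard : (W.biUnion fun x => (nb x).image fun y => (x, y)).card ≤ m * K :=
      Finset.card_biUnion_le_card_mul _ _ _ fun x _ => Finset.card_image_le.trans (hnbK x)
    refine (Learnable.pairs _ fun C₂ hC₂ ⟨o₀, ho₀⟩ hE => ?_).mono (Nat.add_le_add_right hcard _)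
    have hC' : ∀ o ∈ C₂, o ∈ C := fun o ho => hC₁ (hC₂ ho)
    have hroot : ∀ o ∈ C₂, desc o W r = W := fun o ho => by
      obtain ⟨r', hr', hle⟩ := (hC o (hC' o ho)).root
      obtain rfl := hmax o (hC₂ ho) r' hr' (hle r hr)
      exact Finset.filter_true_of_mem hle
    have hcardS : (W.erase r).card = m - 1 := Finset.card_erase_of_mem hr
    have hstate : IsSearchState W d e t nb (fun x => desc o₀ (nb x) x) C₂ (W.erase r) ∅ [] := {
      isTreeOn := fun o ho => hC o (hC' o ho)
      out_eq := fun o ho x hx => Finset.filter_congr fun y hy => by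
        rw [hE o ho o₀ ho₀ (x, y) (Finset.mem_biUnion.2 ⟨x, hx, Finset.mem_image_of_mem _ hy⟩)]
      subset := Finset.erase_subset _ _
      le_card := by omega
      closed := fun o ho x hx y hy hxy => by
        have := (hC o (hC' o ho)).strictDesc_closed (W := W) (x := r) (y := x) (z := y)
        rw [hroot o ho] at this
        exact this hx hy hxy
      card_tops := fun o ho => by
        have := (hC o (hC' o ho)).degree r hr
        rwa [hroot o ho] at this
      removed_subset := Finset.empty_subset _
      removed_light := by simp
      removed_closed := by simp
      removed_known := fun o ho o' ho' z _ => by simp [desc]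
      found_subset := by simp
      found_notMem := by simp
      found_pairwise := List.Pairwise.nil
      found_live := by simp }
    -- 34K = 2K + 4 · 8K, by m/t ≤ 8K. The terms 2e, Kt and K are each at most m/4.
    refine hstate.learnable_splits (K := K) (34 * K) hnb hnbW (by nlinarith) ?_ ht0 ?_ ?_
    · nlinarith
    · intro o _ z _
      simpa [desc] using he0
    · have := Nat.div_le_div_right (c := t) (hcardS.le.trans (Nat.sub_le m 1))
      simp only [Finset.sdiff_empty, List.length_nil]
      omega
  · obtain ⟨k, rfl⟩ : ∃ k, K = k + 1 := ⟨K - 1, by omega⟩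
    rw [← hm]
    have h₁ : (1 : ℕ) + ((k + 1) + (34 * (k + 1) + ((k + 1) * (d + 1) + d + 1) * 2)) ≤
        (k + 1) * (40 + 4 * d) := by
      have : 0 ≤ k * d := Nat.zero_le _
      linarith [mul_add k 40 (4 * d), add_mul k 1 (40 + 4 * d), mul_add k d 1]
    calc _ = m * (1 + ((k + 1) + (34 * (k + 1) + ((k + 1) * (d + 1) + d + 1) * 2))) := by ring
      _ ≤ m * ((k + 1) * (40 + 4 * d)) := Nat.mul_le_mul_left _ h₁
      _ = _ := by ring

theorem IsTreeOn.desc_isTreeOn {o : V → V → Bool} {s : V} (ho : IsTreeOn o W d) (hs : s ∈ W) :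
    IsTreeOn o (desc o W s) d where
  toIsForestOrder := ho.toIsForestOrder
  root := ⟨s, mem_desc.2 ⟨hs, ho.refl s⟩, fun _ hx => (mem_desc.1 hx).2⟩
  degree x hx := by
    have : desc o (desc o W s) x = desc o W x := by
      ext y
      simp only [mem_desc] at hx ⊢
      exact ⟨fun h => ⟨h.1.1, h.2⟩, fun h => ⟨⟨h.1, ho.trans hx.2 h.2⟩, h.2⟩⟩
    rw [this]
    exact ho.degree x (mem_desc.1 hx).1

theorem IsTreeOn.sdiff_desc_isTreeOn {o : V → V → Bool} {s : V} (ho : IsTreeOn o W d)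
    (hs : desc o W s ≠ W) : IsTreeOn o (W \ desc o W s) d where
  toIsForestOrder := ho.toIsForestOrder
  root := by
    obtain ⟨r, hr, hle⟩ := ho.root
    refine ⟨r, Finset.mem_sdiff.2 ⟨hr, fun hrs => hs ?_⟩, fun x hx =>
      hle x (Finset.mem_sdiff.1 hx).1⟩
    exact Finset.filter_true_of_mem fun x hx => ho.trans (mem_desc.1 hrs).2 (hle x hx)
  degree x hx := by
    refine (Finset.card_le_card fun y hy => ?_).trans (ho.degree x (Finset.mem_sdiff.1 hx).1)
    simp only [mem_tops, Finset.mem_erase, mem_desc, Finset.mem_sdiff] at hy ⊢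
    refine ⟨⟨hy.1.1, hy.1.2.1.1, hy.1.2.2⟩, fun z hz hzy => hy.2 z ⟨hz.1, ⟨hz.2.1, ?_⟩, hz.2.2⟩ hzy⟩
    exact fun hsz => hy.1.2.1.2 ⟨hy.1.2.1.1, ho.trans hsz.2 hzy⟩

/-- The order of growth of the number of queries per vertex. -/
noncomputable def queryRate (m : ℕ) : ℝ := Real.sqrt (m * Real.log (m + 2))

theorem one_le_queryRate {m : ℕ} (hm : 1 ≤ m) : 1 ≤ queryRate m := by
  have h₁ : (1 : ℝ) ≤ m := by exact_mod_cast hm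
  rw [queryRate, Real.one_le_sqrt]
  have h₂ : (1 : ℝ) ≤ Real.log (m + 2) := by
    rw [Real.le_log_iff_exp_le (by positivity)]
    have := Real.exp_one_lt_d9
    norm_num at this ⊢
    linarith
  nlinarith

/-- The logarithm is monotone and 1 - ε ≤ (1 - ε/2)². -/
theorem queryRate_le {a m : ℕ} {ε : ℝ} (hε : ε ≤ 1) (ha : (a : ℝ) ≤ (1 - ε) * m) (ham : a ≤ m) :
    queryRate a ≤ (1 - ε / 2) * queryRate m := by
  have h₁ : (a : ℝ) ≤ m := by exact_mod_cast ham
  have h₂ : Real.log (a + 2) ≤ Real.log (m + 2) := Real.log_le_log (by positivity) (by linarith)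
  have h₃ : 0 ≤ Real.log ((m : ℝ) + 2) := Real.log_nonneg (by linarith [Nat.cast_nonneg (α := ℝ) m])
  have h₄ : 0 ≤ Real.log ((a : ℝ) + 2) := Real.log_nonneg (by linarith [Nat.cast_nonneg (α := ℝ) a])
  rw [queryRate, queryRate]
  refine Real.sqrt_le_iff.2 ⟨mul_nonneg (by linarith) (Real.sqrt_nonneg _), ?_⟩
  rw [mul_pow, Real.sq_sqrt (by positivity)]
  calc (a : ℝ) * Real.log (a + 2) ≤ ((1 - ε) * m) * Real.log (m + 2) := by gcongr
    _ = (1 - ε) * (m * Real.log (m + 2)) := by ring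
    _ ≤ (1 - ε / 2) ^ 2 * (m * Real.log (m + 2)) := by
      gcongr
      nlinarith [sq_nonneg ε]

theorem eventually_queryRate_le : ∀ᶠ m : ℕ in atTop, 12 * queryRate m ≤ m := by
  have h₁ : (fun x : ℝ => Real.log x) =o[atTop] (fun x : ℝ => x) := Real.isLittleO_log_id_atTop
  -- 432 = 3 · 12², where the 3 comes from m + 2 ≤ 3m.
  have h₂ := (h₁.bound (c := 1 / 432) (by norm_num))
  have h₃ : Tendsto (fun m : ℕ => (m : ℝ) + 2) atTop atTop :=
    tendsto_atTop_add_const_right _ _ tendsto_natCast_atTop_atTop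
  filter_upwards [h₃.eventually h₂, eventually_ge_atTop 1] with m hm hm1
  have hm1 : (1 : ℝ) ≤ m := by exact_mod_cast hm1
  rw [Real.norm_of_nonneg (Real.log_nonneg (by linarith)), Real.norm_of_nonneg (by linarith)] at hm
  have : queryRate m ≤ m / 12 := by
    rw [queryRate, Real.sqrt_le_iff]
    refine ⟨by positivity, ?_⟩
    nlinarith
  linarith

theorem exists_learnable_order (d : ℕ) : ∃ B : ℝ, 0 ≤ B ∧
    ∀ {V : Type*} [DecidableEq V] (W : Finset V) (C : Set (V → V → Bool)),
      (∀ o ∈ C, IsTreeOn o W d) →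
      Learnable (fun C' => ∀ o ∈ C', ∀ o' ∈ C', ∀ x ∈ W, ∀ y ∈ W, o x y = o' x y) C
        ⌊B * (W.card * queryRate W.card)⌋₊ := by
  obtain ⟨m₀, hm₀⟩ := eventually_atTop.1 eventually_queryRate_le
  set N : ℝ := 16 * (d + 1) with hN
  -- Both parts have size at most (1 - 1/N)m, so recursion saves a fraction 1/(2N) of the budget.
  -- This pays 3(40 + 4d) for the split and 1 for the gluing column. The second summand covers
  -- querying all pairs when m is small.
  set B : ℝ := 2 * N * (121 + 12 * d) + (m₀ + 8 * (d + 1)) with hB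
  have hN0 : 0 < N := by positivity
  have hB0 : 0 ≤ B := by positivity
  refine ⟨B, hB0, fun {V} _ W => ?_⟩
  induction hcard : W.card using Nat.strong_induction_on generalizing W with
  | _ m ih =>
  subst hcard
  intro C hC
  set m := W.card with hm
  rcases Nat.eq_zero_or_pos m with h0 | hpos
  · refine .done fun _ o _ o' _ x hx => ?_
    exact absurd (Finset.card_pos.2 ⟨x, hx⟩) (by omega)
  have hrate := one_le_queryRate hpos
  have hmR : (1 : ℝ) ≤ m := by exact_mod_cast hpos
  rcases lt_or_ge m (m₀ + 8 * (d + 1)) with hsmall | hlarge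
  · refine (Learnable.pairs (q := 0) (W ×ˢ W) fun C' _ _ hE => .done fun _ o ho o' ho' x hx y hy =>
      hE o ho o' ho' (x, y) (Finset.mk_mem_product hx hy)).mono ?_
    rw [Finset.card_product, add_zero, ← hm]
    refine Nat.le_floor ?_
    have h₁ : (m : ℝ) ≤ B := by
      have : (m : ℝ) ≤ m₀ + 8 * (d + 1) := by exact_mod_cast hsmall.le
      have : 0 ≤ 2 * N * (121 + 12 * d) := by positivity
      linarith
    push_cast
    calc (m : ℝ) * m ≤ B * (m * 1) := by rw [mul_one]; gcongr
      _ ≤ B * (m * queryRate m) := by gcongr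
  · set K := ⌊2 * queryRate m⌋₊ + 1 with hK
    have hK₁ : 2 * queryRate m < K := by
      rw [hK]; push_cast; exact Nat.lt_floor_add_one _
    have hK₂ : (K : ℝ) ≤ 3 * queryRate m := by
      rw [hK]
      push_cast
      linarith [Nat.floor_le (show 0 ≤ 2 * queryRate m by linarith)]
    have hKm : 4 * K ≤ m := by
      have h₁ := hm₀ m (by omega)
      have h₂ : (4 * K : ℝ) ≤ m := by linarith
      exact_mod_cast h₂
    have hlog : 2 * m * Real.log m < K * K := by
      have h₁ : queryRate m ^ 2 = m * Real.log (m + 2) :=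
        Real.sq_sqrt (mul_nonneg (by linarith) (Real.log_nonneg (by linarith)))
      have h₂ : Real.log m ≤ Real.log (m + 2) := Real.log_le_log (by linarith) (by linarith)
      nlinarith [mul_le_mul_of_nonneg_left h₂ (show (0 : ℝ) ≤ m by linarith)]
    set e := m / (8 * (d + 1)) with he
    have he0 : 0 < e := Nat.div_pos (by omega) (by omega)
    have hme : (m : ℝ) ≤ N * e := by
      have h₁ : m < 8 * (d + 1) * (e + 1) := Nat.lt_mul_div_succ m (by omega)
      have h₂ : m ≤ 16 * (d + 1) * e := by nlinarith
      rw [hN]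
      exact_mod_cast h₂
    have hpart : ∀ a : ℕ, a + e ≤ m → queryRate a ≤ (1 - 1 / N / 2) * queryRate m := by
      intro a ha
      refine queryRate_le ?_ ?_ (by omega)
      · rw [div_le_one hN0, hN]
        linarith [Nat.cast_nonneg (α := ℝ) d]
      · have h₁ : (a : ℝ) + e ≤ m := by exact_mod_cast ha
        have h₂ : 1 / N * m ≤ e := by
          rw [div_mul_eq_mul_div, one_mul, div_le_iff₀ hN0]
          linarith
        linarith
    have hsum : ∀ a b : ℕ, a + b = m → a + e ≤ m → b + e ≤ m → m * K * (40 + 4 * d) +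
        (⌊B * (a * queryRate a)⌋₊ + (⌊B * (b * queryRate b)⌋₊ + m)) ≤
        ⌊B * (m * queryRate m)⌋₊ := by
      intro a b hab ha hb
      refine Nat.le_floor ?_
      have hfl : ∀ a : ℕ, (⌊B * (a * queryRate a)⌋₊ : ℝ) ≤ B * (a * queryRate a) := fun a =>
        Nat.floor_le (mul_nonneg hB0 (mul_nonneg (Nat.cast_nonneg a) (Real.sqrt_nonneg _)))
      have h₁ : (⌊B * (a * queryRate a)⌋₊ : ℝ) ≤ B * (a * ((1 - 1 / N / 2) * queryRate m)) :=
        (hfl a).trans (by gcongr; exact hpart a ha)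
      have h₂ : (⌊B * (b * queryRate b)⌋₊ : ℝ) ≤ B * (b * ((1 - 1 / N / 2) * queryRate m)) :=
        (hfl b).trans (by gcongr; exact hpart b hb)
      have h₃ : (a : ℝ) + b = m := by exact_mod_cast hab
      have h₄ : (m : ℝ) * K * (40 + 4 * d) ≤ m * (3 * queryRate m) * (40 + 4 * d) := by gcongr
      have h₅ : 121 + 12 * (d : ℝ) ≤ B / N / 2 := by
        rw [div_div, le_div_iff₀ (by positivity), hB]
        have : (0 : ℝ) ≤ m₀ + 8 * (d + 1) := by positivity
        linarith
      have h₆ : (121 + 12 * (d : ℝ)) * (m * queryRate m) ≤ B / N / 2 * (m * queryRate m) := by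
        gcongr
      have h₇ : (m : ℝ) ≤ m * queryRate m := le_mul_of_one_le_right (by linarith) hrate
      push_cast
      calc _ ≤ (m : ℝ) * (3 * queryRate m) * (40 + 4 * d) +
            (B * (a * ((1 - 1 / N / 2) * queryRate m)) +
            (B * (b * ((1 - 1 / N / 2) * queryRate m)) + m * queryRate m)) := by gcongr
        _ = (121 + 12 * (d : ℝ)) * (m * queryRate m) + B * (((a : ℝ) + b) * queryRate m) -
            B / N / 2 * (((a : ℝ) + b) * queryRate m) := by rw [h₃]; rw [← h₃]; ring
        _ ≤ B * (m * queryRate m) := by rw [h₃]; linarith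
    set T := ⌊B * (m * queryRate m)⌋₊ with hT
    -- Any admissible sizes, here e and m - e, show that the subtraction T - mK(40 + 4d) is not
    -- truncated.
    have hF : m * K * (40 + 4 * d) ≤ T := by
      have h₁ : e * (8 * (d + 1)) ≤ m := Nat.div_mul_le_self _ _
      have h₂ : e + e ≤ m := by nlinarith
      have := hsum e (m - e) (by omega) h₂ (by omega)
      omega
    refine ((learnable_splits (K := K) hC (Nat.succ_pos _) hKm (by omega) hlog).bind
      (q' := T - m * K * (40 + 4 * d))
      fun C₁ hC₁ ⟨o₁, ho₁⟩ ⟨s, hs, D, hDW, hD₁, hD₂, hD⟩ => ?_).mono (Nat.add_sub_cancel' hF).le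
    have hD₁ : e ≤ D.card := hD₁
    have hD₂ : D.card + e ≤ m := hD₂
    have hDm : D.card ≤ m := Finset.card_le_card hDW
    have hcardD : (W \ D).card = m - D.card := Finset.card_sdiff_of_subset hDW
    have hT' := hsum D.card (W \ D).card (by omega) hD₂ (by omega)
    have hDne : D ≠ W := by
      intro hDW'
      rw [hDW', ← hm] at hD₂
      omega
    refine ((ih D.card (by omega) D rfl C₁ fun o ho =>
      hD o ho ▸ (hC o (hC₁ ho)).desc_isTreeOn hs).bind
      (q' := ⌊B * ((W \ D).card * queryRate (W \ D).card)⌋₊ + m) fun C₂ hC₂ _ hP₂ =>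
      (ih (W \ D).card (by omega) (W \ D) rfl C₂ fun o ho => ?_).bind fun C₃ hC₃ _ hP₃ =>
      Learnable.column W s (q := 0) fun C₄ hC₄ _ hcol => .done fun _ => ?_).mono (by omega)
    · have hDo := hD o (hC₂ ho)
      rw [← hDo] at hDne ⊢
      exact (hC o (hC₁ (hC₂ ho))).sdiff_desc_isTreeOn hDne
    have hD' : ∀ o ∈ C₄, desc o W s = D := fun o ho => hD o (hC₂ (hC₃ (hC₄ ho)))
    have hC' : ∀ o ∈ C₄, IsTreeOn o W d := fun o ho => hC o (hC₁ (hC₂ (hC₃ (hC₄ ho))))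
    have hout : ∀ o ∈ C₄, ∀ x ∈ D, ∀ y ∈ W, y ∉ D → o x y = false := by
      intro o ho x hx y hy hyD
      rw [← hD' o ho, mem_desc] at hx hyD
      by_contra hxy
      exact hyD ⟨hy, (hC' o ho).trans hx.2 (by simpa using hxy)⟩
    -- A vertex outside the subtree of s enters it only through s, so the column of s settles all
    -- these pairs.
    have hin : ∀ o ∈ C₄, ∀ x ∈ W, x ∉ D → ∀ y ∈ D, o x y = o x s := by
      intro o ho x hx hxD y hy
      rw [← hD' o ho, mem_desc] at hxD hy
      refine Bool.eq_iff_iff.2 ⟨fun hxy => ?_, fun hxs => (hC' o ho).trans hxs hy.2⟩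
      exact ((hC' o ho).comparable hxy hy.2).resolve_right fun hsx => hxD ⟨hx, hsx⟩
    intro o ho o' ho' x hx y hy
    by_cases hxD : x ∈ D <;> by_cases hyD : y ∈ D
    · exact hP₂ o (hC₃ (hC₄ ho)) o' (hC₃ (hC₄ ho')) x hxD y hyD
    · rw [hout o ho x hxD y hy hyD, hout o' ho' x hxD y hy hyD]
    · rw [hin o ho x hx hxD y hyD, hin o' ho' x hx hxD y hyD, hcol o ho o' ho' x hx]
    · exact hP₃ o (hC₄ ho) o' (hC₄ ho') x (Finset.mem_sdiff.2 ⟨hx, hxD⟩) y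
        (Finset.mem_sdiff.2 ⟨hy, hyD⟩)

end Recursion

/-! ### From reachability orders back to trees and algorithms -/

section Graph

variable {V : Type*} {G : Digraph V} {r u v : V} {d : ℕ}

theorem exists_isDirPath_iff : (∃ p, IsDirPath G u v p) ↔ Relation.ReflTransGen G.Adj u v := by
  constructor
  · rintro ⟨p, hu, hv, hp⟩
    have hne : p ≠ [] := by
      rintro rfl
      simp at hu
    have := List.relationReflTransGen_of_exists_isChain p hp hne
    rwa [(List.head_eq_iff_head?_eq_some hne).2 hu, (List.getLast_eq_iff_getLast?_eq_some hne).2 hv]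
      at this
  · intro h
    obtain ⟨l, hl, hlast⟩ := List.exists_isChain_cons_of_relationReflTransGen h
    exact ⟨u :: l, rfl, (List.getLast_eq_iff_getLast?_eq_some _).1 hlast, hl⟩

theorem pathQuery_eq_true_iff : pathQuery G u v = true ↔ Relation.ReflTransGen G.Adj u v := by
  simp [pathQuery, exists_isDirPath_iff]

namespace IsRootedTree

/-- Extending the root paths of two parents by v gives two paths to v, which must coincide. -/
theorem adj_left_unique (h : IsRootedTree G r) {a b : V} (ha : G.Adj a v) (hb : G.Adj b v) :
    a = b := by
  have key : ∀ a p, G.Adj a v → IsDirPath G r a p → IsDirPath G r v (p ++ [v]) := by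
    rintro a p hav ⟨hr, ha, hp⟩
    refine ⟨by simp [hr], by simp, List.isChain_append.2 ⟨hp, List.isChain_singleton _, ?_⟩⟩
    intro x hx y hy
    rw [ha, Option.mem_some] at hx
    rw [List.head?_singleton, Option.mem_some] at hy
    exact hx ▸ hy ▸ hav
  obtain ⟨p, hp, -⟩ := h.existsUnique_path a
  obtain ⟨q, hq, -⟩ := h.existsUnique_path b
  have heq := (h.existsUnique_path v).unique (key a p ha hp) (key b q hb hq)
  have hlast := hp.2.1
  rw [List.append_cancel_right heq, hq.2.1] at hlast
  exact (Option.some.inj hlast).symm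

theorem isForestOrder (h : IsRootedTree G r) : IsForestOrder (pathQuery G) where
  refl x := pathQuery_eq_true_iff.2 .refl
  trans := by
    simp only [pathQuery_eq_true_iff]
    exact fun h₁ h₂ => h₁.trans h₂
  antisymm := by
    simp only [pathQuery_eq_true_iff]
    intro x y hxy hyx
    rcases Relation.reflTransGen_iff_eq_or_transGen.1 hxy with heq | hlt
    · exact heq.symm
    · exact absurd (hlt.trans_left hyx) (h.acyclic x)
  comparable := by
    simp only [pathQuery_eq_true_iff]
    intro x y z hx hy
    have := Relation.ReflTransGen.total_of_right_unique (r := Function.swap G.Adj)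
      (fun _ _ _ h₁ h₂ => h.adj_left_unique h₁ h₂) (Relation.reflTransGen_swap.2 hx)
      (Relation.reflTransGen_swap.2 hy)
    exact this.symm.imp Relation.reflTransGen_swap.1 Relation.reflTransGen_swap.1

theorem reaches (h : IsRootedTree G r) (v : V) : pathQuery G r v = true :=
  pathQuery_eq_true_iff.2 (exists_isDirPath_iff.1 (h.existsUnique_path v).exists)

theorem adj_iff (h : IsRootedTree G r) : G.Adj u v ↔ u ≠ v ∧ pathQuery G u v = true ∧
    ∀ w, pathQuery G u w = true → pathQuery G w v = true → w = u ∨ w = v := by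
  constructor
  · intro huv
    refine ⟨?_, pathQuery_eq_true_iff.2 (.single huv), fun w huw hwv => ?_⟩
    · rintro rfl
      exact h.acyclic _ (.single huv)
    · rcases Relation.ReflTransGen.cases_tail (pathQuery_eq_true_iff.1 hwv) with heq | ⟨x, hwx, hxv⟩
      · exact .inr heq.symm
      · obtain rfl := h.adj_left_unique hxv huv
        exact .inl (h.isForestOrder.antisymm (pathQuery_eq_true_iff.2 hwx) huw)
  · rintro ⟨hne, huv, hw⟩
    rcases Relation.ReflTransGen.cases_tail (pathQuery_eq_true_iff.1 huv) with heq | ⟨x, hux, hxv⟩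
    · exact absurd heq.symm hne
    · rcases hw x (pathQuery_eq_true_iff.2 hux) (pathQuery_eq_true_iff.2 (.single hxv))
        with rfl | rfl
      · exact hxv
      · exact absurd (.single hxv) (h.acyclic x)

theorem isTreeOn [Fintype V] [DecidableEq V] (h : IsRootedTree G r) (hd : MaxDegreeLE G d) :
    IsTreeOn (pathQuery G) Finset.univ d where
  toIsForestOrder := h.isForestOrder
  root := ⟨r, Finset.mem_univ r, fun x _ => h.reaches x⟩
  degree u _ := by
    refine le_trans ?_ ((Nat.le_add_left _ _).trans (hd u))
    rw [← Set.ncard_coe_finset]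
    refine Set.ncard_le_ncard (fun v hv => ?_) (Set.toFinite _)
    obtain ⟨hv, htop⟩ := mem_tops.1 (Finset.mem_coe.1 hv)
    obtain ⟨hvu, hv⟩ := Finset.mem_erase.1 hv
    refine h.adj_iff.2 ⟨hvu.symm, (mem_desc.1 hv).2, fun w huw hwv => ?_⟩
    refine or_iff_not_imp_left.2 fun hwu => htop w ?_ hwv
    exact Finset.mem_erase.2 ⟨hwu, mem_desc.2 ⟨Finset.mem_univ w, huw⟩⟩

theorem eq_of_pathQuery_eq {G' : Digraph V} {r' : V} (h : IsRootedTree G r)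
    (h' : IsRootedTree G' r') (heq : pathQuery G = pathQuery G') : (r, G) = (r', G') := by
  refine Prod.ext (h.isForestOrder.antisymm (h.reaches r') ?_) (Digraph.ext ?_)
  · rw [heq]
    exact h'.reaches r
  · ext u v
    change G.Adj u v ↔ G'.Adj u v
    rw [h.adj_iff, h'.adj_iff, heq]

end IsRootedTree

/-- At a leaf, output any rooted tree whose path oracle is consistent with the answers; the order
determines it. If there is none, the output is irrelevant. -/
theorem Learnable.exists_algorithm [Nonempty V] {P : Set (V → V → Bool) → Prop}
    {C : Set (V → V → Bool)} {q : ℕ} (h : Learnable P C q)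
    (hP : ∀ C' ⊆ C, P C' → ∀ o ∈ C', ∀ o' ∈ C', o = o') :
    ∃ A : PathQueryAlgorithm V, ∀ (G : Digraph V) (r : V), IsRootedTree G r → pathQuery G ∈ C →
      A.run (pathQuery G) = (r, G) ∧ A.numQueries (pathQuery G) ≤ q := by
  induction h with
  | @done C q h =>
    by_cases hex : ∃ (G : Digraph V) (r : V), IsRootedTree G r ∧ pathQuery G ∈ C
    · obtain ⟨G₀, r₀, h₀, hC₀⟩ := hex
      refine ⟨.output r₀ G₀, fun G r hG hC => ⟨?_, Nat.zero_le _⟩⟩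
      exact h₀.eq_of_pathQuery_eq hG (hP C subset_rfl (h ⟨_, hC⟩) _ hC₀ _ hC)
    · obtain ⟨r₀⟩ := ‹Nonempty V›
      exact ⟨.output r₀ ⟨fun _ _ => False⟩, fun G r hG hC => absurd ⟨G, r, hG, hC⟩ hex⟩
  | @query C q u v _ _ ih₁ ih₂ =>
    obtain ⟨A₁, hA₁⟩ := ih₁ fun C' hC' => hP C' (hC'.trans (Set.sep_subset _ _))
    obtain ⟨A₂, hA₂⟩ := ih₂ fun C' hC' => hP C' (hC'.trans (Set.sep_subset _ _))
    refine ⟨.query u v A₁ A₂, fun G r hG hC => ?_⟩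
    cases hb : pathQuery G u v with
    | true =>
      obtain ⟨h₁, h₂⟩ := hA₁ G r hG ⟨hC, hb⟩
      simp only [PathQueryAlgorithm.run, PathQueryAlgorithm.numQueries, hb]
      exact ⟨h₁, Nat.succ_le_succ h₂⟩
    | false =>
      obtain ⟨h₁, h₂⟩ := hA₂ G r hG ⟨hC, hb⟩
      simp only [PathQueryAlgorithm.run, PathQueryAlgorithm.numQueries, hb]
      exact ⟨h₁, Nat.succ_le_succ h₂⟩

end Graph

/-! ### Asymptotics and conclusion -/

theorem isBigO_mul_queryRate (B : ℝ) (hB : 0 ≤ B) :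
    (fun n : ℕ => (⌊B * (n * queryRate n)⌋₊ : ℝ)) =O[atTop]
      (fun n : ℕ => (n : ℝ) ^ (3 / 2 : ℝ) * Real.sqrt (Real.log (n : ℝ))) := by
  refine IsBigO.of_bound (2 * B) ?_
  filter_upwards [eventually_ge_atTop 2] with n hn
  have hn' : (2 : ℝ) ≤ n := by exact_mod_cast hn
  have hlog : 0 ≤ Real.log n := Real.log_nonneg (by linarith)
  -- For n ≥ 2, n + 2 ≤ n² already gives the factor 2; the weaker 2² has an exact square root.
  have h₁ : Real.log (n + 2) ≤ 2 ^ 2 * Real.log n := by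
    have : Real.log (n + 2) ≤ Real.log ((n : ℝ) ^ 2) :=
      Real.log_le_log (by positivity) (by nlinarith)
    rw [Real.log_pow] at this
    push_cast at this
    linarith
  have h₂ : queryRate n ≤ 2 * (Real.sqrt n * Real.sqrt (Real.log n)) := by
    rw [← Real.sqrt_mul (by positivity), queryRate]
    refine Real.sqrt_le_iff.2 ⟨by positivity, ?_⟩
    rw [mul_pow, Real.sq_sqrt (by positivity)]
    nlinarith
  have h₃ : (n : ℝ) ^ (3 / 2 : ℝ) = n * Real.sqrt n := by
    rw [show (3 / 2 : ℝ) = 1 + 1 / 2 by norm_num, Real.rpow_add (by positivity), Real.rpow_one,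
      Real.sqrt_eq_rpow]
  have hq : 0 ≤ queryRate n := Real.sqrt_nonneg _
  rw [Real.norm_of_nonneg (Nat.cast_nonneg _), Real.norm_of_nonneg (by positivity), h₃]
  calc (⌊B * (n * queryRate n)⌋₊ : ℝ) ≤ B * (n * queryRate n) := Nat.floor_le (by positivity)
    _ ≤ B * (n * (2 * (Real.sqrt n * Real.sqrt (Real.log n)))) := by gcongr
    _ = _ := by ring

theorem mainTheorem2 (d : ℕ) :
    ∃ Q : ℕ → ℕ,
      ((fun n : ℕ => (Q n : ℝ)) =O[atTop]
        (fun n : ℕ => (n : ℝ) ^ (3 / 2 : ℝ) * Real.sqrt (Real.log (n : ℝ)))) ∧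
      ∀ (V : Type*) [Fintype V] [Nonempty V],
        ∃ A : PathQueryAlgorithm V, A.LearnsRootedTrees d (Q (Fintype.card V)) := by
  classical
  obtain ⟨B, hB, hlearn⟩ := exists_learnable_order d
  refine ⟨fun n => ⌊B * (n * queryRate n)⌋₊, isBigO_mul_queryRate B hB, fun V _ _ => ?_⟩
  obtain ⟨A, hA⟩ := (hlearn (Finset.univ : Finset V) {o | IsTreeOn o Finset.univ d}
    fun _ ho => ho).exists_algorithm fun C' _ hP o ho o' ho' =>
      funext₂ fun x y => hP o ho o' ho' x (Finset.mem_univ x) y (Finset.mem_univ y)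
  exact ⟨A, fun G r hG hd => hA G r hG (hG.isTreeOn hd)⟩
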